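/- For a complex algebraic number $\alpha$, let $M_\alpha\in\mathbb Z[T]$ be its minimal polynomial over $\mathbb Z$, that is, the polynomial, unique up to sign, that is irreducible in $\mathbb Z[T]$ and vanishes at $\alpha$; let $|M_\alpha|$ be the maximum of the absolute values of its coefficients. For a positive integer $m$, let $U_m$ be the set of complex transcendental numbers $\gamma$ such that $m$ is the smallest positive integer with the following property: for every real $w>0$ there exist infinitely many complex algebraic numbers $\alpha$ of degree $m$ over $\mathbb Q$ satisfying $|\gamma-\alpha|<|M_\alpha|^{-w}$. Let $f(z)=\sum_{n=1}^{\infty}z^{n!}$ be the classical Liouville series, which converges for $|z|<1$. Let $m$ be a positive integer and let $\alpha\in\mathbb Q$ satisfy $0<\alpha<1$. Assume that, for every prime $p$ dividing $m$, $\alpha$ is not a $p$-th power in $\mathbb Q$. Let $\alpha^{1/m}\in\mathbb C$ be any determination of the $m$-th root, that is, any complex number $\beta$ with $\beta^m=\alpha$. Then $f(\alpha^{1/m})\in U_m$. For instance, $f(2^{-1/m})\in U_m$ for every positive integer $m$. -/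

import Mathlib

/-- `P` is a minimal polynomial `M_α` of the algebraic number `α` over `ℤ`: it is irreducible in
`ℤ[T]` and vanishes at `α`. For a given algebraic `α` it is unique up to sign, so its height
`|M_α|` depends only on `α`. -/
def IsIntMinpoly (P : Polynomial ℤ) (α : ℂ) : Prop :=
  Irreducible P ∧ Polynomial.aeval α P = 0

/-- The complex algebraic numbers `α` of degree `m` with `|γ - α| < |M_α|^{-w}`, where `|P|` is the
maximal absolute value of the coefficients of `P`. -/
def goodApproximations (γ : ℂ) (m : ℕ) (w : ℝ) : Set ℂ :=
  {α : ℂ | IsAlgebraic ℚ α ∧ (minpoly ℚ α).natDegree = m ∧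
    ∃ P : Polynomial ℤ, IsIntMinpoly P α ∧ ‖γ - α‖ < P.supNorm ^ (-w)}

/-- The set `U_m`: the complex transcendental numbers `γ` such that `m` is the smallest positive
integer with the property that for every `w > 0` there are infinitely many algebraic numbers `α`
of degree `m` with `|γ - α| < |M_α|^{-w}`. -/
def UNumbers (m : ℕ) : Set ℂ :=
  {γ : ℂ | Transcendental ℚ γ ∧
    IsLeast {k : ℕ | 0 < k ∧ ∀ w : ℝ, 0 < w → (goodApproximations γ k w).Infinite} m}

/-- The Liouville series `f(z) = ∑_{n ≥ 1} z^{n!}`. -/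
noncomputable def liouvilleSeries (z : ℂ) : ℂ :=
  ∑' n : ℕ, z ^ (n + 1).factorial

/-- The Liouville series converges in the open unit disc, and `liouvilleSeries` is its sum. -/
theorem hasSum_liouvilleSeries {z : ℂ} (hz : ‖z‖ < 1) :
    HasSum (fun n : ℕ => z ^ (n + 1).factorial) (liouvilleSeries z) := by
  refine Summable.hasSum ?_
  refine Summable.of_norm_bounded (summable_geometric_of_lt_one (norm_nonneg z) hz) fun n => ?_
  rw [norm_pow]
  exact pow_le_pow_of_le_one (norm_nonneg z) hz.le
    ((Nat.le_succ n).trans (Nat.self_le_factorial (n + 1)))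

/-! For `n ≥ m` the factorial `n!` is divisible by `m`, so `β ^ n!` is the rational number `a ^ (n!
/ m)`. Hence `f(β) = ξ + L`, where `ξ` is the finite sum over `n < m`, an element of `ℚ(β)`, and `L`
is a real lacunary series. Up to a constant its partial sums `A_N / B_N` have error `B_N ^ (-c (N +
1))`, while `B_(N+1) ≤ B_N ^ (D (N + 1))`; this is `IsFastApproximation`.

For such `L` and any algebraic `ξ` of degree `m`, `ξ + L` lies in `U_m` (`add_mem_UNumbers`). It is
transcendental because `L` is a Liouville number. The translates `ξ + A_N / B_N` have degree `m` and
height `O(B_N ^ m)`, so they approximate to every order. For `k < m`, a nonzero integer polynomial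
of degree `k` and height `H` cannot vanish at a translate, and taking norms bounds the distance from
the translate to any bounded root `η` below by a constant times `B ^ (-mk) H ^ (-m)`. The growth
condition supplies an `N` whose error is below this bound although `log B_N = O(log H)`, so `η`
cannot be too close to `ξ + L`.

It remains to see that `ξ` has degree `m` (`natDegree_minpoly_sum_factorial`). The hypothesis on
prime powers gives `β` degree `m`. A conjugate `z` of `β` with `∑ z ^ n! = ∑ |z| ^ n!` must equal
`|z|`, so `ξ` generates `ℚ(β)`. -/

/-! ### Polynomial estimates and a Liouville inequality at translates -/

open Polynomial in
theorem Polynomial.one_le_supNorm_of_ne_zero {P : ℤ[X]} (hP : P ≠ 0) : 1 ≤ P.supNorm := by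
  refine le_trans ?_ (P.le_supNorm P.natDegree)
  have h : P.coeff P.natDegree ≠ 0 := by simpa using hP
  rw [Int.norm_eq_abs]
  exact_mod_cast Int.one_le_abs h

theorem norm_pow_sub_pow_le_mul {x y : ℂ} {S : ℝ} (hS : 1 ≤ S) (hx : ‖x‖ ≤ S) (hy : ‖y‖ ≤ S)
    (n : ℕ) : ‖x ^ n - y ^ n‖ ≤ n * S ^ n * ‖x - y‖ := by
  induction n with
  | zero => simp
  | succ n ih =>
    have h : x ^ (n + 1) - y ^ (n + 1) = x ^ n * (x - y) + (x ^ n - y ^ n) * y := by ring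
    have h1 : ‖x ^ n‖ ≤ S ^ (n + 1) := by
      rw [norm_pow]
      exact (pow_le_pow_left₀ (norm_nonneg x) hx n).trans
        (pow_le_pow_right₀ hS (Nat.le_succ n))
    rw [h]
    calc _ ≤ ‖x ^ n‖ * ‖x - y‖ + ‖x ^ n - y ^ n‖ * ‖y‖ := by
          simpa only [norm_mul] using norm_add_le (x ^ n * (x - y)) ((x ^ n - y ^ n) * y)
      _ ≤ S ^ (n + 1) * ‖x - y‖ + n * S ^ n * ‖x - y‖ * S := by gcongr
      _ = _ := by push_cast; ring

open Polynomial in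
/-- A Lipschitz bound for integer polynomials on a disc, in terms of degree and height. -/
theorem norm_aeval_sub_aeval_le (P : ℤ[X]) {x y : ℂ} {S : ℝ} (hS : 1 ≤ S) (hx : ‖x‖ ≤ S)
    (hy : ‖y‖ ≤ S) :
    ‖aeval x P - aeval y P‖ ≤
      (P.natDegree + 1) * (P.natDegree * S ^ P.natDegree) * P.supNorm * ‖x - y‖ := by
  simp only [aeval_eq_sum_range, ← Finset.sum_sub_distrib, ← smul_sub]
  refine (norm_sum_le _ _).trans ?_
  have : ∀ i ∈ Finset.range (P.natDegree + 1), ‖P.coeff i • (x ^ i - y ^ i)‖ ≤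
      P.natDegree * S ^ P.natDegree * P.supNorm * ‖x - y‖ := by
    intro i hi
    have hi' : i ≤ P.natDegree := by simpa [Nat.lt_succ_iff] using hi
    calc _ ≤ ‖P.coeff i‖ * ‖x ^ i - y ^ i‖ := norm_smul_le _ _
      _ ≤ P.supNorm * (i * S ^ i * ‖x - y‖) := by
          gcongr
          · exact P.supNorm_nonneg
          · exact P.le_supNorm i
          · exact norm_pow_sub_pow_le_mul hS hx hy i
      _ ≤ P.supNorm * (P.natDegree * S ^ P.natDegree * ‖x - y‖) := by
          gcongr
          exact P.supNorm_nonneg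
      _ = _ := by ring
  refine (Finset.sum_le_sum this).trans_eq ?_
  simp; ring

open Polynomial in
theorem norm_aeval_le_supNorm (P : ℤ[X]) {x : ℂ} {S : ℝ} (hS : 1 ≤ S) (hx : ‖x‖ ≤ S) :
    ‖aeval x P‖ ≤ (P.natDegree + 1) * S ^ P.natDegree * P.supNorm := by
  rw [aeval_eq_sum_range]
  refine (norm_sum_le _ _).trans ?_
  have : ∀ i ∈ Finset.range (P.natDegree + 1), ‖P.coeff i • x ^ i‖ ≤
      S ^ P.natDegree * P.supNorm := by
    intro i hi
    have hi' : i ≤ P.natDegree := by simpa [Nat.lt_succ_iff] using hi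
    calc _ ≤ ‖P.coeff i‖ * ‖x ^ i‖ := norm_smul_le _ _
      _ ≤ P.supNorm * S ^ P.natDegree := by
          gcongr
          · exact P.supNorm_nonneg
          · exact P.le_supNorm i
          · rw [norm_pow]
            exact (pow_le_pow_left₀ (norm_nonneg x) hx i).trans (pow_le_pow_right₀ hS hi')
      _ = _ := by ring
  refine (Finset.sum_le_sum this).trans_eq ?_
  simp; ring

open Polynomial in
theorem isIntegral_pow_mul_aeval {K : Type*} [Field K] (P : ℤ[X]) {x : K} {D : ℤ}
    (hx : IsIntegral ℤ ((D : K) * x)) :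
    IsIntegral ℤ ((D : K) ^ P.natDegree * aeval x P) := by
  rw [aeval_eq_sum_range, Finset.mul_sum]
  refine IsIntegral.sum _ fun i hi => ?_
  have hi' : i ≤ P.natDegree := by simpa [Nat.lt_succ_iff] using hi
  have h : (D : K) ^ P.natDegree * P.coeff i • x ^ i =
      ((P.coeff i * D ^ (P.natDegree - i) : ℤ) : K) * ((D : K) * x) ^ i := by
    obtain ⟨j, hj⟩ := Nat.exists_eq_add_of_le hi'
    rw [hj, Nat.add_sub_cancel_left, zsmul_eq_mul]
    push_cast
    ring
  rw [h]
  exact isIntegral_algebraMap.mul (hx.pow i)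

/-- The norm of a nonzero algebraic integer is a nonzero integer; all conjugates except the one at
`σ` are bounded by the house. -/
theorem NumberField.one_le_norm_mul_house_pow {K : Type*} [Field K] [NumberField K] {y : K}
    (hy : y ≠ 0) (hint : IsIntegral ℤ y) (σ : K →+* ℂ) :
    1 ≤ ‖σ y‖ * NumberField.house y ^ (Module.finrank ℚ K - 1) := by
  refine le_trans ?_ (NumberField.norm_norm_le_norm_mul_house_pow y σ)
  have h1 : IsIntegral ℤ (Algebra.norm ℚ y) := Algebra.isIntegral_norm ℚ hint
  obtain ⟨z, hz⟩ := IsIntegrallyClosed.isIntegral_iff.mp h1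
  have hz0 : z ≠ 0 := by
    rintro rfl
    exact Algebra.norm_ne_zero_iff.mpr hy (by rw [← hz, map_zero])
  rw [← hz, ← Rat.norm_cast_real]
  have h2 : (1 : ℝ) ≤ |(z : ℝ)| := by exact_mod_cast Int.one_le_abs hz0
  simpa using h2

theorem NumberField.house_le {K : Type*} [Field K] [NumberField K] {y : K} {X : ℝ} (hX : 0 ≤ X)
    (h : ∀ σ : K →+* ℂ, ‖σ y‖ ≤ X) : NumberField.house y ≤ X :=
  (pi_norm_le_iff_of_nonneg hX).mpr h

open Polynomial IntermediateField in
/-- A Liouville type lower bound for integer polynomials evaluated at rational translates of a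
fixed algebraic number. -/
theorem exists_one_le_mul_norm_aeval_add_rat {ξ : ℂ} (hξ : IsAlgebraic ℚ ξ) (k : ℕ) (R : ℝ) :
    ∃ C : ℝ, 1 ≤ C ∧ ∀ P : ℤ[X], P.natDegree = k → ∀ (A : ℤ) (B : ℕ), 0 < B →
      |(A / B : ℝ)| ≤ R → aeval (ξ + A / B) P ≠ 0 →
      1 ≤ C * (B : ℝ) ^ ((minpoly ℚ ξ).natDegree * k) *
        P.supNorm ^ ((minpoly ℚ ξ).natDegree - 1) * ‖aeval (ξ + A / B) P‖ := by
  set m := (minpoly ℚ ξ).natDegree with hm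
  have hint : IsIntegral ℚ ξ := hξ.isIntegral
  have hm0 : 0 < m := minpoly.natDegree_pos hint
  have : FiniteDimensional ℚ ℚ⟮ξ⟯ := adjoin.finiteDimensional hint
  have : NumberField ℚ⟮ξ⟯ := { }
  have hfin : Module.finrank ℚ ℚ⟮ξ⟯ = m := adjoin.finrank hint
  set g : ℚ⟮ξ⟯ := AdjoinSimple.gen ℚ ξ with hg
  have halg : IsAlgebraic ℤ g :=
    (IsFractionRing.isAlgebraic_iff ℤ ℚ ℚ⟮ξ⟯).mpr (Algebra.IsAlgebraic.isAlgebraic g)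
  obtain ⟨d, hd0, hd⟩ := halg.exists_integral_multiple
  rw [zsmul_eq_mul] at hd
  -- Bounds every conjugate of `g + A / B` at once.
  set S : ℝ := NumberField.house g + |R| + 1 with hS
  have hS1 : 1 ≤ S := by
    have := NumberField.house_nonneg g
    have := abs_nonneg R
    linarith
  have hd1 : (1 : ℝ) ≤ |(d : ℝ)| := by exact_mod_cast Int.one_le_abs hd0
  have hX1 : 1 ≤ (k + 1) * S ^ k := by
    have : 1 ≤ S ^ k := one_le_pow₀ hS1
    have : (0 : ℝ) ≤ k := Nat.cast_nonneg k
    nlinarith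
  -- The denominator factor `|d| ^ k` occurs for all `m` conjugates, the size factor only for the `m
  -- - 1` bounded by the house.
  refine ⟨(|(d : ℝ)| ^ k) ^ m * ((k + 1) * S ^ k) ^ (m - 1),
    one_le_mul_of_one_le_of_one_le (one_le_pow₀ (one_le_pow₀ hd1)) (one_le_pow₀ hX1), ?_⟩
  intro P hP A B hB hAB hne
  have hB0 : (B : ℚ⟮ξ⟯) ≠ 0 := by exact_mod_cast hB.ne'
  set x : ℚ⟮ξ⟯ := g + A / B with hx
  have hxint : IsIntegral ℤ (((d * B : ℤ) : ℚ⟮ξ⟯) * x) := by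
    have : ((d * B : ℤ) : ℚ⟮ξ⟯) * x = ((B : ℤ) : ℚ⟮ξ⟯) * (d * g) + ((d * A : ℤ) : ℚ⟮ξ⟯) := by
      rw [hx]
      push_cast
      field_simp
    rw [this]
    exact (isIntegral_algebraMap.mul hd).add isIntegral_algebraMap
  have hyint := isIntegral_pow_mul_aeval P hxint
  set y : ℚ⟮ξ⟯ := ((d * B : ℤ) : ℚ⟮ξ⟯) ^ P.natDegree * aeval x P with hy
  have hσy : ∀ σ : ℚ⟮ξ⟯ →+* ℂ, ‖σ y‖ = (|(d : ℝ)| ^ k * B ^ k) * ‖aeval (σ g + A / B) P‖ := by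
    intro σ
    have h1 : σ (aeval x P) = aeval (σ g + A / B) P := by
      have := (aeval_algHom_apply σ.toIntAlgHom x P).symm
      simpa [hx] using this
    rw [hy, map_mul, map_pow, map_intCast, h1, norm_mul, norm_pow, hP, ← mul_pow]
    simp
  have hval : (algebraMap ℚ⟮ξ⟯ ℂ) g = ξ := AdjoinSimple.algebraMap_gen ℚ ξ
  have hy0 : y ≠ 0 := by
    intro h0
    have := hσy (algebraMap ℚ⟮ξ⟯ ℂ)
    rw [h0, map_zero, norm_zero, hval] at this
    have h2 : 0 < (|(d : ℝ)| ^ k * (B : ℝ) ^ k) * ‖aeval (ξ + A / B) P‖ := by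
      have := norm_pos_iff.mpr hne
      positivity
    linarith
  have hhouse : NumberField.house y ≤
      (|(d : ℝ)| ^ k * B ^ k) * (((k + 1) * S ^ k) * P.supNorm) := by
    have hnn := P.supNorm_nonneg
    refine NumberField.house_le (by positivity) fun σ => ?_
    rw [hσy]
    gcongr
    have hle : ‖σ g + A / B‖ ≤ S := by
      refine (norm_add_le _ _).trans ?_
      have h1 := NumberField.norm_embedding_le_house g σ
      have h2 : ‖(A / B : ℂ)‖ = |(A / B : ℝ)| := by simp [abs_div]
      have := le_abs_self R
      rw [h2]
      linarith
    simpa [hP] using norm_aeval_le_supNorm P hS1 hle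
  have key := NumberField.one_le_norm_mul_house_pow hy0 hyint (algebraMap ℚ⟮ξ⟯ ℂ)
  rw [hfin, hσy, hval] at key
  refine key.trans ?_
  calc _ ≤ (|(d : ℝ)| ^ k * B ^ k) * ‖aeval (ξ + A / B) P‖ *
        ((|(d : ℝ)| ^ k * B ^ k) * (((k + 1) * S ^ k) * P.supNorm)) ^ (m - 1) := by
        gcongr
        exact NumberField.house_nonneg y
    _ = _ := by
        obtain ⟨j, hj⟩ : ∃ j, m = j + 1 := ⟨m - 1, by omega⟩
        rw [hj, Nat.add_sub_cancel]
        simp only [mul_pow, ← pow_mul]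
        ring

/-! ### Minimal polynomials and heights of rational translates -/

open Polynomial in
theorem Polynomial.supNorm_primPart_le (G : ℤ[X]) (hG : G ≠ 0) :
    G.primPart.supNorm ≤ G.supNorm := by
  obtain ⟨i, hi⟩ := G.primPart.exists_eq_supNorm
  rw [hi]
  refine le_trans ?_ (G.le_supNorm i)
  conv_rhs => rw [G.eq_C_content_mul_primPart, coeff_C_mul, norm_mul]
  refine le_mul_of_one_le_left (norm_nonneg _) ?_
  rw [Int.norm_eq_abs]
  exact_mod_cast Int.one_le_abs (content_eq_zero_iff.not.mpr hG)

open Polynomial in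
/-- An integer polynomial of minimal degree vanishing at `x` has primitive part `M_x`. -/
theorem isIntMinpoly_primPart {G : ℤ[X]} (hG : G ≠ 0) {x : ℂ} (hx : IsIntegral ℚ x)
    (hdeg : G.natDegree = (minpoly ℚ x).natDegree) (hroot : aeval x G = 0) :
    IsIntMinpoly G.primPart x := by
  have hroot' : aeval x G.primPart = 0 := by
    rw [G.eq_C_content_mul_primPart, map_mul, aeval_C, mul_eq_zero] at hroot
    refine hroot.resolve_left fun h => hG (content_eq_zero_iff.mp ?_)
    simpa using h
  refine ⟨?_, hroot'⟩
  rw [IsPrimitive.Int.irreducible_iff_irreducible_map_cast G.isPrimitive_primPart]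
  have hmap : aeval x (G.primPart.map (Int.castRingHom ℚ)) = 0 :=
    (aeval_map_algebraMap ℚ x G.primPart).trans hroot'
  have hinj : Function.Injective (Int.castRingHom ℚ) := Int.cast_injective
  have hne : G.primPart.map (Int.castRingHom ℚ) ≠ 0 :=
    (Polynomial.map_ne_zero_iff hinj).mpr G.primPart_ne_zero
  have hdvd := minpoly.dvd ℚ x hmap
  have hass : Associated (minpoly ℚ x) (G.primPart.map (Int.castRingHom ℚ)) :=
    associated_of_dvd_of_natDegree_le hdvd hne
      (by rw [natDegree_map_eq_of_injective hinj, natDegree_primPart, hdeg])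
  exact hass.irreducible (minpoly.irreducible hx)

open Polynomial in
theorem exists_int_polynomial_natDegree_eq {x : ℂ} (hx : IsIntegral ℚ x) :
    ∃ Q : ℤ[X], Q ≠ 0 ∧ Q.natDegree = (minpoly ℚ x).natDegree ∧ aeval x Q = 0 := by
  have hne := minpoly.ne_zero hx
  refine ⟨IsLocalization.integerNormalization (nonZeroDivisors ℤ) (minpoly ℚ x),
    IsFractionRing.integerNormalization_eq_zero_iff.not.mpr hne, ?_,
    IsLocalization.integerNormalization_aeval_eq_zero _ _ (minpoly.aeval ℚ x)⟩
  obtain ⟨b, hb, h⟩ := IsLocalization.integerNormalization_spec (nonZeroDivisors ℤ) (minpoly ℚ x)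
  have hinj : Function.Injective (algebraMap ℤ ℚ) := Int.cast_injective
  rw [← natDegree_map_eq_of_injective hinj, h]
  exact natDegree_smul_of_smul_regular _ ((IsSMulRegular.of_ne_zero (nonZeroDivisors.ne_zero hb)))

open Polynomial in
theorem natDegree_minpoly_add_rat (x : ℂ) (r : ℚ) :
    (minpoly ℚ (x + r)).natDegree = (minpoly ℚ x).natDegree := by
  have := minpoly.add_algebraMap x r
  rw [eq_ratCast] at this
  rw [this, natDegree_comp]
  simp

open Polynomial in
theorem Polynomial.map_hasseDeriv {R S : Type*} [Semiring R] [Semiring S] (f : R →+* S) (k : ℕ)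
    (p : R[X]) : (hasseDeriv k p).map f = hasseDeriv k (p.map f) := by
  ext n
  simp [hasseDeriv_coeff]

open Polynomial in
/-- Rational translates of a fixed algebraic number have height polynomially bounded in the
denominator. -/
theorem exists_isIntMinpoly_add_rat {ξ : ℂ} (hξ : IsIntegral ℚ ξ) (R : ℝ) :
    ∃ C : ℝ, 1 ≤ C ∧ ∀ (A : ℤ) (B : ℕ), 0 < B → |(A / B : ℝ)| ≤ R →
      ∃ P : ℤ[X], IsIntMinpoly P (ξ + A / B) ∧
        P.supNorm ≤ C * (B : ℝ) ^ (minpoly ℚ ξ).natDegree := by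
  obtain ⟨Q, hQ0, hQdeg, hQroot⟩ := exists_int_polynomial_natDegree_eq hξ
  set m := (minpoly ℚ ξ).natDegree with hm
  set S : ℝ := |R| + 1 with hS
  have hS1 : 1 ≤ S := by have := abs_nonneg R; linarith
  set F : ℕ → ℝ := fun j => ((hasseDeriv j Q).natDegree + 1) * S ^ (hasseDeriv j Q).natDegree *
    (hasseDeriv j Q).supNorm with hF
  have hF0 : ∀ j, 0 ≤ F j := fun j => by
    have := (hasseDeriv j Q).supNorm_nonneg
    positivity
  refine ⟨1 + ∑ j ∈ Finset.range (m + 1), F j, by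
    have := Finset.sum_nonneg fun j (_ : j ∈ Finset.range (m + 1)) => hF0 j
    linarith, ?_⟩
  intro A B hB hAB
  have hBC : (B : ℂ) ≠ 0 := by exact_mod_cast hB.ne'
  -- This is `B ^ m Q(X - A / B)` with denominators cleared. Its coefficients are `B ^ m` times the
  -- divided derivatives of `Q` at `-A / B`, which `F` bounds.
  set G : ℤ[X] := ∑ i ∈ Finset.range (m + 1),
    C (Q.coeff i) * (C (B : ℤ) * X - C A) ^ i * C (B : ℤ) ^ (m - i) with hG
  have hmap : G.map (Int.castRingHom ℂ) =
      C ((B : ℂ) ^ m) * taylor (-(A / B : ℂ)) (Q.map (Int.castRingHom ℂ)) := by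
    rw [taylor_apply, comp, eval₂_map, eval₂_eq_sum_range, hQdeg, Finset.mul_sum, hG,
      Polynomial.map_sum]
    refine Finset.sum_congr rfl fun i hi => ?_
    have hi' : i ≤ m := by simpa [Nat.lt_succ_iff] using hi
    obtain ⟨j, hj⟩ := Nat.exists_eq_add_of_le hi'
    have h1 : (C (B : ℂ) * X - C (A : ℂ)) = C (B : ℂ) * (X + C (-(A / B : ℂ))) := by
      rw [mul_add, ← C_mul, mul_neg, mul_div_cancel₀ _ hBC, C_neg, sub_eq_add_neg]
    rw [hj, Nat.add_sub_cancel_left]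
    simp only [Polynomial.map_mul, Polynomial.map_pow, Polynomial.map_sub, map_C, map_X,
      RingHom.comp_apply]
    rw [eq_intCast (Int.castRingHom ℂ) A, eq_intCast (Int.castRingHom ℂ) (B : ℤ),
      Int.cast_natCast, h1, mul_pow, C_pow]
    ring
  have hinj : Function.Injective (Int.castRingHom ℂ) := Int.cast_injective
  have hGdeg : G.natDegree = m := by
    rw [← natDegree_map_eq_of_injective hinj, hmap, natDegree_C_mul (pow_ne_zero _ hBC),
      natDegree_taylor, natDegree_map_eq_of_injective hinj, hQdeg]
  have hGroot : aeval (ξ + A / B) G = 0 := by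
    have h1 : aeval (ξ + A / B) G = (G.map (Int.castRingHom ℂ)).eval (ξ + A / B) := by
      rw [eval_map, aeval_def]; rfl
    have h2 : aeval ξ Q = (Q.map (Int.castRingHom ℂ)).eval ξ := by
      rw [eval_map, aeval_def]; rfl
    rw [h1, hmap, eval_mul, taylor_eval, add_neg_cancel_right, ← h2, hQroot, mul_zero]
  have hr : (ξ + A / B : ℂ) = ξ + ((A / B : ℚ) : ℂ) := by push_cast; rfl
  have hdeg : (minpoly ℚ (ξ + A / B : ℂ)).natDegree = m := by
    rw [hr, natDegree_minpoly_add_rat]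
  have hint : IsIntegral ℚ (ξ + A / B : ℂ) := by
    rw [hr]
    exact hξ.add (isIntegral_algebraMap (R := ℚ) (x := (A / B : ℚ)))
  have hG0 : G ≠ 0 := by
    refine ne_zero_of_natDegree_gt (n := 0) ?_
    rw [hGdeg]
    exact minpoly.natDegree_pos hξ
  refine ⟨G.primPart, isIntMinpoly_primPart hG0 hint (hGdeg.trans hdeg.symm) hGroot,
    (G.supNorm_primPart_le hG0).trans ?_⟩
  obtain ⟨j, hj⟩ := G.exists_eq_supNorm
  rw [hj]
  have hsum := Finset.sum_nonneg fun j (_ : j ∈ Finset.range (m + 1)) => hF0 j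
  by_cases hjm : j ≤ m
  · have h1 : ‖G.coeff j‖ = (B : ℝ) ^ m * ‖aeval (-(A / B : ℂ)) (hasseDeriv j Q)‖ := by
      have h2 : ((G.coeff j : ℤ) : ℂ) = (B : ℂ) ^ m * aeval (-(A / B : ℂ)) (hasseDeriv j Q) := by
        have := congrArg (fun p => coeff p j) hmap
        simp only [coeff_map, coeff_C_mul, taylor_coeff, ← map_hasseDeriv, eval_map] at this
        exact this
      have h3 : ‖G.coeff j‖ = ‖((G.coeff j : ℤ) : ℂ)‖ := by
        rw [Complex.norm_intCast, Int.norm_eq_abs]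
      rw [h3, h2, norm_mul, norm_pow, Complex.norm_natCast]
    rw [h1, mul_comm]
    gcongr
    have hle : ‖(-(A / B : ℂ))‖ ≤ S := by
      have h2 : ‖(-(A / B : ℂ))‖ = |(A / B : ℝ)| := by simp [abs_div]
      have := le_abs_self R
      rw [h2]
      linarith
    have h4 : F j ≤ ∑ j ∈ Finset.range (m + 1), F j :=
      Finset.single_le_sum (f := F) (fun i _ => hF0 i) (by simpa [Nat.lt_succ_iff] using hjm)
    have := norm_aeval_le_supNorm (hasseDeriv j Q) hS1 hle
    linarith
  · rw [coeff_eq_zero_of_natDegree_lt (by omega), norm_zero]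
    exact mul_nonneg (by linarith) (pow_nonneg (Nat.cast_nonneg B) m)

/-! ### Degrees of the radical and of the truncated series -/

/-- A positive rational which is not a `p`-th power for any prime `p ∣ m` has order `m` modulo
`m`-th powers. -/
theorem Rat.dvd_of_pow_eq_pow {m d : ℕ} (hm : 0 < m) {a c : ℚ} (ha : 0 < a) (hc : 0 < c)
    (hroot : ∀ p : ℕ, p.Prime → p ∣ m → ¬ ∃ r : ℚ, r ^ p = a) (h : c ^ m = a ^ d) : m ∣ d := by
  obtain ⟨g, m', d', hg, hcop, rfl, rfl⟩ := Nat.exists_coprime' (Nat.gcd_pos_of_pos_left d hm)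
  have h' : c ^ m' = a ^ d' := by
    rw [pow_mul, pow_mul] at h
    exact (pow_left_inj₀ (by positivity) (by positivity) hg.ne').mp h
  by_cases hm1 : m' = 1
  · simp [hm1]
  obtain ⟨p, hp, q, rfl⟩ := Nat.exists_prime_and_dvd hm1
  -- Bézout: if `pq u + d' v = 1`, then `(a ^ u c ^ v) ^ (pq) = a`, because `c ^ (pq) = a ^ d'`.
  refine absurd ⟨(a ^ (Nat.gcdA (p * q) d') * c ^ (Nat.gcdB (p * q) d')) ^ q, ?_⟩
    (hroot p hp (by rw [mul_assoc]; exact Nat.dvd_mul_right p _))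
  have hb := Nat.gcd_eq_gcd_ab (p * q) d'
  rw [Nat.Coprime.gcd_eq_one hcop] at hb
  rw [← pow_mul, mul_comm q p, mul_pow, ← zpow_natCast, ← zpow_natCast, ← zpow_mul,
    mul_comm _ ((p * q : ℕ) : ℤ), ← zpow_mul, mul_comm _ ((p * q : ℕ) : ℤ), zpow_mul c,
    zpow_natCast c, h', ← zpow_natCast a d', ← zpow_mul, ← zpow_add₀ ha.ne', ← hb]
  simp

open Polynomial in
/-- The radical `a ^ (1 / m)` has degree `m`. -/
theorem natDegree_minpoly_of_pow_eq {m : ℕ} (hm : 0 < m) {a : ℚ} (ha : 0 < a)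
    (hroot : ∀ p : ℕ, p.Prime → p ∣ m → ¬ ∃ r : ℚ, r ^ p = a) {β : ℂ} (hβ : β ^ m = (a : ℂ)) :
    IsIntegral ℚ β ∧ (minpoly ℚ β).natDegree = m := by
  have hmonic : (X ^ m - C a : ℚ[X]).Monic := monic_X_pow_sub_C a hm.ne'
  have haev : ∀ z : ℂ, aeval z (X ^ m - C a : ℚ[X]) = z ^ m - a := fun z => by simp
  have hβ' : aeval β (X ^ m - C a : ℚ[X]) = 0 := by rw [haev, hβ, sub_self]
  have hint : IsIntegral ℚ β := ⟨_, hmonic, hβ'⟩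
  have hdvd := minpoly.dvd ℚ β hβ'
  refine ⟨hint, le_antisymm ?_ (Nat.le_of_dvd (minpoly.natDegree_pos hint) ?_)⟩
  · simpa using natDegree_le_of_dvd hdvd hmonic.ne_zero
  have hnorm : ∀ z : ℂ, z ^ m = a → ‖z‖ ^ m = a := fun z hz => by
    rw [← norm_pow, hz]
    simpa using ha.le
  have hβpos : 0 < ‖β‖ := by
    refine norm_pos_iff.mpr ?_
    rintro rfl
    rw [zero_pow hm.ne'] at hβ
    exact ha.ne (by exact_mod_cast hβ)
  set P := (minpoly ℚ β).map (algebraMap ℚ ℂ) with hP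
  have hPmonic : P.Monic := (minpoly.monic hint).map _
  -- All roots of `X ^ m - a` share one modulus, so the constant term of the minimal polynomial, of
  -- degree `d`, has absolute value `c` with `c ^ m = a ^ d`. This rational relation forces `m ∣ d`.
  have hroots : ∀ z ∈ P.roots, ‖z‖ = ‖β‖ := by
    intro z hz
    have hz0 : aeval z (minpoly ℚ β) = 0 := by
      have := (mem_roots'.mp hz).2
      rwa [hP, IsRoot.def, eval_map, ← aeval_def] at this
    have hzm : z ^ m = a := by
      have := aeval_eq_zero_of_dvd_aeval_eq_zero hdvd hz0
      rwa [haev, sub_eq_zero] at this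
    exact (pow_left_inj₀ (norm_nonneg z) (norm_nonneg β) hm.ne').mp
      ((hnorm z hzm).trans (hnorm β hβ).symm)
  have hcoeff : ‖P.coeff 0‖ = ‖β‖ ^ (minpoly ℚ β).natDegree := by
    have hs : P.Splits := IsAlgClosed.splits P
    have hprod : ‖P.roots.prod‖ = (P.roots.map (‖·‖)).prod :=
      map_multiset_prod (normHom : ℂ →*₀ ℝ) _
    rw [hs.coeff_zero_eq_prod_roots_of_monic hPmonic, norm_mul, norm_pow, norm_neg, norm_one,
      one_pow, one_mul, hprod, Multiset.map_congr rfl hroots,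
      Multiset.map_const', Multiset.prod_replicate, ← hs.natDegree_eq_card_roots, hP,
      (minpoly.monic hint).natDegree_map]
  set c : ℚ := |(minpoly ℚ β).coeff 0| with hc
  have hcβ : (c : ℝ) = ‖β‖ ^ (minpoly ℚ β).natDegree := by
    rw [← hcoeff, hP, coeff_map]
    simp [hc]
  refine Rat.dvd_of_pow_eq_pow hm ha (c := c) ?_ hroot ?_
  · have : (0 : ℝ) < c := by rw [hcβ]; positivity
    exact_mod_cast this
  · have : (c : ℝ) ^ m = (a : ℝ) ^ (minpoly ℚ β).natDegree := by
      rw [hcβ, ← hnorm β hβ, ← pow_mul, ← pow_mul, mul_comm]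
    exact_mod_cast this

/-- Real parts are compared termwise: each is at most the modulus, and strictly less in the
exponent-one term unless `z = |z|`. -/
theorem eq_of_sum_pow_eq {ι : Type*} (s : Finset ι) (e : ι → ℕ) {i₀ : ι} (hi₀ : i₀ ∈ s)
    (he : e i₀ = 1) {z : ℂ} (h : ∑ i ∈ s, (‖z‖ : ℂ) ^ e i = ∑ i ∈ s, z ^ e i) : (‖z‖ : ℂ) = z := by
  by_contra hne
  have hlt : z.re < ‖z‖ := by
    refine lt_of_le_of_ne (Complex.re_le_norm z) fun h0 => hne ?_
    have := Complex.re_eq_norm.mp h0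
    exact (Complex.eq_coe_norm_of_nonneg this).symm
  have hs := congrArg Complex.re h
  rw [Complex.re_sum, Complex.re_sum] at hs
  have hre : ∀ n : ℕ, (((‖z‖ : ℂ)) ^ n).re = ‖z‖ ^ n := fun n => by
    rw [← Complex.ofReal_pow, Complex.ofReal_re]
  simp only [hre] at hs
  refine (Finset.sum_lt_sum (f := fun i => (z ^ e i).re) (g := fun i => ‖z‖ ^ e i)
    (fun i _ => ?_) ⟨i₀, hi₀, ?_⟩).ne hs.symm
  · rw [← norm_pow]
    exact Complex.re_le_norm _
  · simpa [he] using hlt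

-- Primitivity is tested against a single embedding, the one with `β ↦ |β|`. It exists because `|β|`
-- is also a root of `X ^ m - a`, the minimal polynomial of `β`.
open Polynomial IntermediateField in
theorem natDegree_minpoly_sum_factorial {m : ℕ} (hm : 0 < m) {a : ℚ} (ha : 0 < a)
    (hroot : ∀ p : ℕ, p.Prime → p ∣ m → ¬ ∃ r : ℚ, r ^ p = a) {β : ℂ} (hβ : β ^ m = (a : ℂ)) :
    (minpoly ℚ (∑ n ∈ Finset.range (m - 1), β ^ (n + 1).factorial)).natDegree = m := by
  obtain ⟨hint, hdeg⟩ := natDegree_minpoly_of_pow_eq hm ha hroot hβ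
  have : FiniteDimensional ℚ ℚ⟮β⟯ := adjoin.finiteDimensional hint
  have hfin : Module.finrank ℚ ℚ⟮β⟯ = m := (adjoin.finrank hint).trans hdeg
  set g : ℚ⟮β⟯ := AdjoinSimple.gen ℚ β with hg
  have hgβ : algebraMap ℚ⟮β⟯ ℂ g = β := AdjoinSimple.algebraMap_gen ℚ β
  have hgm : g ^ m = algebraMap ℚ ℚ⟮β⟯ a := by
    apply (algebraMap ℚ⟮β⟯ ℂ).injective
    rw [map_pow, hgβ, hβ, ← IsScalarTower.algebraMap_apply, eq_ratCast]
  set x : ℚ⟮β⟯ := ∑ n ∈ Finset.range (m - 1), g ^ (n + 1).factorial with hx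
  have hxval : algebraMap ℚ⟮β⟯ ℂ x = ∑ n ∈ Finset.range (m - 1), β ^ (n + 1).factorial := by
    simp only [hx, map_sum, map_pow, hgβ]
  rw [← hxval, minpoly.algebraMap_eq (algebraMap ℚ⟮β⟯ ℂ).injective, ← hfin,
    ← Field.primitive_element_iff_minpoly_natDegree_eq]
  have hconj : ∀ ψ : ℚ⟮β⟯ →ₐ[ℚ] ℂ, ψ g ^ m = a := fun ψ => by
    rw [← map_pow, hgm, AlgHom.commutes, eq_ratCast]
  have hnorm : ∀ z : ℂ, z ^ m = a → ‖z‖ = ‖β‖ := fun z hz => by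
    refine (pow_left_inj₀ (norm_nonneg z) (norm_nonneg β) hm.ne').mp ?_
    rw [← norm_pow, ← norm_pow, hz, hβ]
  have hρm : (‖β‖ : ℂ) ^ m = a := by
    rw [← Complex.ofReal_pow, ← norm_pow, hβ, Complex.norm_ratCast, ← Rat.cast_abs,
      abs_of_pos ha]
    simp
  have hmin : X ^ m - C a = minpoly ℚ β :=
    eq_of_monic_of_dvd_of_natDegree_le (minpoly.monic hint)
      (monic_X_pow_sub_C a hm.ne') (minpoly.dvd ℚ β (by simp [hβ]))
      (by rw [natDegree_X_pow_sub_C, hdeg])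
  let pb := adjoin.powerBasis hint
  have hpb : pb.gen = g := rfl
  have hroot' : aeval (‖β‖ : ℂ) (minpoly ℚ pb.gen) = 0 := by
    have : minpoly ℚ pb.gen = minpoly ℚ β := by
      rw [hpb, ← minpoly.algebraMap_eq (algebraMap ℚ⟮β⟯ ℂ).injective, hgβ]
    rw [this, ← hmin]
    simp [hρm]
  let φ : ℚ⟮β⟯ →ₐ[ℚ] ℂ := pb.lift (‖β‖ : ℂ) hroot'
  have hφ : φ g = ‖β‖ := pb.lift_gen _ hroot'
  refine (Field.primitive_element_iff_algHom_eq_of_eval ℚ ℂ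
    (fun y => IsAlgClosed.splits _) x φ).mpr fun ψ hψ => pb.algHom_ext (hφ.trans ?_)
  rw [hpb]
  have hz := hconj ψ
  rw [hx, map_sum, map_sum] at hψ
  simp only [map_pow, hφ] at hψ
  rw [← hnorm _ hz] at hψ ⊢
  -- For `m = 1` the sum is empty and carries no information, but then every conjugate is `a`
  -- itself.
  rcases Nat.lt_or_ge m 2 with h2 | h2
  · obtain rfl : m = 1 := by omega
    rw [pow_one] at hz hρm
    rw [hnorm _ (by rw [pow_one, hz])]
    exact hρm.trans hz.symm
  · exact eq_of_sum_pow_eq _ (fun n => (n + 1).factorial) (i₀ := 0)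
      (by simp; omega) (by simp) hψ

/-! ### Separation from algebraic numbers of smaller degree -/

open Polynomial in
theorem IsIntMinpoly.ne_zero_and_natDegree {P : ℤ[X]} {x : ℂ} (hP : IsIntMinpoly P x) :
    P ≠ 0 ∧ P.natDegree = (minpoly ℚ x).natDegree := by
  obtain ⟨hirr, hroot⟩ := hP
  have hdeg : P.natDegree ≠ 0 := fun h0 => hirr.ne_zero <| by
    rw [eq_C_of_natDegree_eq_zero h0] at hroot ⊢
    rw [aeval_C, eq_intCast, Int.cast_eq_zero] at hroot
    rw [hroot, C_0]
  have hinj : Function.Injective (Int.castRingHom ℚ) := Int.cast_injective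
  have hirr' := (IsPrimitive.Int.irreducible_iff_irreducible_map_cast
    (hirr.isPrimitive hdeg)).mp hirr
  have hroot' : aeval x (P.map (Int.castRingHom ℚ)) = 0 := (aeval_map_algebraMap ℚ x P).trans hroot
  refine ⟨hirr.ne_zero, ?_⟩
  rw [← minpoly.eq_of_irreducible hirr' hroot', natDegree_mul_C, natDegree_map_eq_of_injective hinj]
  exact inv_ne_zero (leadingCoeff_ne_zero.mpr hirr'.ne_zero)

open Polynomial in
theorem finite_setOf_natDegree_le_supNorm_le (k : ℕ) (X : ℝ) :
    {P : ℤ[X] | P.natDegree ≤ k ∧ P.supNorm ≤ X}.Finite := by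
  have hfin : (Set.univ.pi fun _ : Fin (k + 1) => Set.Icc (-⌈X⌉) ⌈X⌉).Finite :=
    Set.Finite.pi fun _ => Set.finite_Icc _ _
  refine Set.Finite.of_finite_image (f := fun P : ℤ[X] => fun i : Fin (k + 1) => P.coeff i)
    (hfin.subset ?_) ?_
  · rintro _ ⟨P, ⟨-, hP⟩, rfl⟩ i -
    have h := (P.le_supNorm i).trans (hP.trans (Int.le_ceil X))
    rw [Int.norm_eq_abs] at h
    exact abs_le.mp (by exact_mod_cast h)
  · rintro P ⟨hP, -⟩ Q ⟨hQ, -⟩ hPQ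
    ext i
    rcases Nat.lt_or_ge k i with h | h
    · rw [coeff_eq_zero_of_natDegree_lt (by omega), coeff_eq_zero_of_natDegree_lt (by omega)]
    · exact congrFun hPQ ⟨i, Nat.lt_succ_of_le h⟩

open Polynomial in
/-- An infinite set of good approximations of fixed degree contains some of large height. -/
theorem exists_mem_goodApproximations_supNorm_gt {γ : ℂ} {k : ℕ} {w : ℝ}
    (h : (goodApproximations γ k w).Infinite) (X : ℝ) :
    ∃ η : ℂ, ∃ P : ℤ[X], P ≠ 0 ∧ P.natDegree = k ∧ aeval η P = 0 ∧ X < P.supNorm ∧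
      ‖γ - η‖ < P.supNorm ^ (-w) := by
  by_contra! hcon
  refine h (((finite_setOf_natDegree_le_supNorm_le k X).biUnion
    fun P _ => P.rootSet_finite ℂ).subset ?_)
  rintro η ⟨-, hdeg, P, hP, hlt⟩
  obtain ⟨h0, h1⟩ := hP.ne_zero_and_natDegree
  rw [hdeg] at h1
  refine Set.mem_biUnion (x := P) ⟨h1.le, ?_⟩ (mem_rootSet.mpr ⟨h0, hP.2⟩)
  by_contra! hX
  exact (hcon η P h0 h1 hP.2 hX).not_gt hlt

open Polynomial in
/-- A Liouville type lower bound for the distance between rational translates of `ξ` and algebraic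
numbers of degree smaller than that of `ξ`. -/
theorem exists_one_le_mul_norm_add_rat_sub {ξ : ℂ} (hξ : IsIntegral ℚ ξ) {k : ℕ}
    (hk : k < (minpoly ℚ ξ).natDegree) (R : ℝ) :
    ∃ C : ℝ, 1 ≤ C ∧ ∀ (P : ℤ[X]) (η : ℂ), P ≠ 0 → P.natDegree = k → aeval η P = 0 → ‖η‖ ≤ R →
      ∀ (A : ℤ) (B : ℕ), 0 < B → |(A / B : ℝ)| ≤ R →
        1 ≤ C * (B : ℝ) ^ ((minpoly ℚ ξ).natDegree * k) *
          P.supNorm ^ (minpoly ℚ ξ).natDegree * ‖ξ + A / B - η‖ := by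
  obtain ⟨C, hC1, hC⟩ := exists_one_le_mul_norm_aeval_add_rat hξ.isAlgebraic k R
  set m := (minpoly ℚ ξ).natDegree with hm
  set S : ℝ := ‖ξ‖ + |R| + 1 with hS
  have hS1 : 1 ≤ S := by
    have := norm_nonneg ξ
    have := abs_nonneg R
    linarith
  have hRS : R ≤ S := by
    have := norm_nonneg ξ
    have := le_abs_self R
    linarith
  set C' : ℝ := (k + 1) * (k * S ^ k) with hC'
  have hC'0 : 0 ≤ C' := by positivity
  -- The summand `1` keeps the constant at least `1`, since `C'` vanishes for `k = 0`.
  refine ⟨C * (1 + C'), one_le_mul_of_one_le_of_one_le hC1 (by linarith), ?_⟩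
  intro P η hP0 hPdeg hPη hη A B hB hAB
  have hnn := P.supNorm_nonneg
  have hne : aeval (ξ + A / B) P ≠ 0 := by
    intro h0
    have hinj : Function.Injective (Int.castRingHom ℚ) := Int.cast_injective
    have h1 : aeval (ξ + A / B) (P.map (Int.castRingHom ℚ)) = 0 :=
      (aeval_map_algebraMap ℚ _ P).trans h0
    have h2 := natDegree_le_of_dvd (minpoly.dvd ℚ _ h1)
      ((Polynomial.map_ne_zero_iff hinj).mpr hP0)
    have hr : (ξ + A / B : ℂ) = ξ + ((A / B : ℚ) : ℂ) := by push_cast; rfl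
    rw [hr, natDegree_minpoly_add_rat, natDegree_map_eq_of_injective hinj] at h2
    omega
  have hx : ‖ξ + A / B‖ ≤ S := by
    refine (norm_add_le _ _).trans ?_
    have h2 : ‖(A / B : ℂ)‖ = |(A / B : ℝ)| := by simp [abs_div]
    have := le_abs_self R
    rw [h2]
    linarith
  have hlip := norm_aeval_sub_aeval_le P hS1 hx (hη.trans hRS)
  rw [hPη, sub_zero, hPdeg] at hlip
  refine (hC P hPdeg A B hB hAB hne).trans ?_
  obtain ⟨j, hj⟩ : ∃ j, m = j + 1 := ⟨m - 1, by omega⟩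
  calc _ ≤ C * (B : ℝ) ^ (m * k) * P.supNorm ^ (m - 1) *
        (C' * P.supNorm * ‖ξ + A / B - η‖) := by gcongr
    _ ≤ C * (B : ℝ) ^ (m * k) * P.supNorm ^ (m - 1) *
        ((1 + C') * P.supNorm * ‖ξ + A / B - η‖) := by gcongr; linarith
    _ = _ := by rw [hj, Nat.add_sub_cancel]; ring

/-! ### Fast rational approximations produce U-numbers -/

/-- For a sequence with `ℓ (N + 1) ≤ D (N + 1) ℓ N`, the intervals
`[ℓ N / W, (c (N + 1) - t) ℓ N)` cover a neighbourhood of infinity. -/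
theorem exists_mem_interval_of_superlinear {ℓ : ℕ → ℝ} {ε D c t : ℝ} (hε : 0 < ε)
    (hℓ : ∀ N, ε ≤ ℓ N) (hD : 0 ≤ D) (hsucc : ∀ N : ℕ, ℓ (N + 1) ≤ D * (N + 1) * ℓ N)
    (hc : 0 < c) :
    ∃ T₀ : ℝ, ∀ T, T₀ ≤ T → ∃ N : ℕ, T < (c * (N + 1) - t) * ℓ N ∧ ℓ N ≤ 2 * D / c * T := by
  -- From `N₀` on, `t` takes away at most half of `c (N + 1)`.
  obtain ⟨N₀, hN₀⟩ := exists_nat_gt (2 * t / c)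
  have hN₀' : 2 * t < c * N₀ := by rwa [div_lt_iff₀' hc] at hN₀
  refine ⟨max 0 ((c * (N₀ + 1) - t) * ℓ N₀), fun T hT => ?_⟩
  have hT0 : 0 ≤ T := (le_max_left _ _).trans hT
  have hTN₀ : (c * (N₀ + 1) - t) * ℓ N₀ ≤ T := (le_max_right _ _).trans hT
  have hex : ∃ N : ℕ, N₀ ≤ N ∧ T < (c * (N + 1) - t) * ℓ N := by
    obtain ⟨M, hM⟩ := exists_nat_gt ((T / ε + t) / c)
    refine ⟨max N₀ M, le_max_left _ _, ?_⟩
    have h1 : T / ε + t < c * M := by rwa [div_lt_iff₀' hc] at hM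
    have h2 : (M : ℝ) ≤ (max N₀ M : ℕ) := by exact_mod_cast le_max_right _ _
    have h3 : T / ε < c * ((max N₀ M : ℕ) + 1) - t := by nlinarith
    have h4 : 0 ≤ T / ε := by positivity
    calc T = T / ε * ε := by field_simp
      _ < (c * ((max N₀ M : ℕ) + 1) - t) * ε := by gcongr
      _ ≤ _ := by
        gcongr
        · linarith
        · exact hℓ _
  classical
  obtain ⟨hN, hTN⟩ := Nat.find_spec hex
  set N := Nat.find hex with hNdef
  obtain ⟨M, hM⟩ : ∃ M, N = M + 1 := by
    refine Nat.exists_eq_succ_of_ne_zero fun h0 => ?_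
    have : N = N₀ := by omega
    rw [this] at hTN
    linarith
  have hMN₀ : N₀ ≤ M := by
    by_contra! hlt
    have : N = N₀ := by omega
    rw [this] at hTN
    linarith
  -- Minimality of `N = M + 1` bounds `ℓ M` by `2 T / (c (M + 1))`; the factor `M + 1` then cancels
  -- against the growth of `ℓ (M + 1)`.
  have hfail : (c * (M + 1) - t) * ℓ M ≤ T := by
    by_contra! hlt
    exact Nat.find_min hex (m := M) (by omega) ⟨hMN₀, hlt⟩
  refine ⟨N, hTN, ?_⟩
  have hMc : (N₀ : ℝ) ≤ M := by exact_mod_cast hMN₀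
  have h1 : c * (M + 1) / 2 ≤ c * (M + 1) - t := by nlinarith
  have hℓM : 0 ≤ ℓ M := hε.le.trans (hℓ M)
  have h2 : c * (M + 1) / 2 * ℓ M ≤ T := (mul_le_mul_of_nonneg_right h1 hℓM).trans hfail
  rw [hM]
  refine (hsucc M).trans ?_
  calc D * (M + 1) * ℓ M = 2 * D / c * (c * (M + 1) / 2 * ℓ M) := by field_simp
    _ ≤ _ := by gcongr

/-- `A N / B N` are rational approximations of `L` whose quality exponents `c (N + 1)` grow
linearly, while the denominators satisfy `B (N + 1) ≤ B N ^ (D (N + 1))`. -/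
structure IsFastApproximation (L : ℝ) (A : ℕ → ℤ) (B : ℕ → ℕ) (c K D : ℝ) : Prop where
  exponent_pos : 0 < c
  one_le_const : 1 ≤ K
  growth_nonneg : 0 ≤ D
  two_le_denom : ∀ N, 2 ≤ B N
  log_denom_succ_le : ∀ N : ℕ, Real.log (B (N + 1)) ≤ D * (N + 1) * Real.log (B N)
  ne : ∀ N, L ≠ A N / B N
  abs_sub_le : ∀ N : ℕ, |L - A N / B N| ≤ K * Real.exp (-(c * (N + 1) * Real.log (B N)))

namespace IsFastApproximation

variable {L : ℝ} {A : ℕ → ℤ} {B : ℕ → ℕ} {c K D : ℝ}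

theorem log_two_le (h : IsFastApproximation L A B c K D) (N : ℕ) :
    Real.log 2 ≤ Real.log (B N) :=
  Real.log_le_log two_pos (by exact_mod_cast h.two_le_denom N)

theorem denom_pos (h : IsFastApproximation L A B c K D) (N : ℕ) : 0 < B N :=
  two_pos.trans_le (h.two_le_denom N)

theorem exp_log_denom (h : IsFastApproximation L A B c K D) (N : ℕ) :
    Real.exp (Real.log (B N)) = B N :=
  Real.exp_log (by exact_mod_cast h.denom_pos N)

/-- The exponent `c (N + 1)` outgrows `u`, and since `log (B N) ≥ log 2` the surplus absorbs `v` and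
`log K`. -/
theorem eventually_abs_sub_lt (h : IsFastApproximation L A B c K D) (u v : ℝ) :
    ∀ᶠ N in Filter.atTop, |L - A N / B N| < Real.exp (-(u * Real.log (B N) + v)) := by
  have hc := h.exponent_pos
  have h2 : 0 < Real.log 2 := Real.log_pos one_lt_two
  have hK : 0 < K := one_pos.trans_le h.one_le_const
  set q : ℝ := (|Real.log K + v| + 1) / Real.log 2 with hq
  obtain ⟨N₀, hN₀⟩ := exists_nat_gt ((q + u) / c)
  filter_upwards [Filter.eventually_ge_atTop N₀] with N hN
  refine (h.abs_sub_le N).trans_lt ?_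
  have hN₀' : q + u < c * N₀ := by rwa [div_lt_iff₀' hc] at hN₀
  have hN' : (N₀ : ℝ) ≤ N := by exact_mod_cast hN
  have h3 : q < c * (N + 1) - u := by nlinarith
  have hq0 : 0 < q := by positivity
  have h4 : |Real.log K + v| + 1 ≤ (c * (N + 1) - u) * Real.log (B N) := by
    calc _ = q * Real.log 2 := by rw [hq]; field_simp
      _ ≤ _ := mul_le_mul h3.le (h.log_two_le N) h2.le (by linarith)
  have h5 := le_abs_self (Real.log K + v)
  calc _ = Real.exp (Real.log K + -(c * (N + 1) * Real.log (B N))) := by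
        rw [Real.exp_add, Real.exp_log hK]
    _ < _ := by
        rw [Real.exp_lt_exp]
        linarith

theorem tendsto (h : IsFastApproximation L A B c K D) :
    Filter.Tendsto (fun N => (A N / B N : ℝ)) Filter.atTop (nhds L) := by
  rw [Metric.tendsto_atTop']
  intro ε hε
  obtain ⟨N, hN⟩ := Filter.eventually_atTop.mp (h.eventually_abs_sub_lt 0 (-Real.log ε))
  refine ⟨N, fun n hn => ?_⟩
  rw [dist_comm, Real.dist_eq]
  simpa [Real.exp_log hε] using hN n hn.le

theorem abs_le (h : IsFastApproximation L A B c K D) (N : ℕ) : |(A N / B N : ℝ)| ≤ |L| + K := by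
  have h1 := h.abs_sub_le N
  have h2 : Real.exp (-(c * (N + 1) * Real.log (B N))) ≤ 1 := by
    refine Real.exp_le_one_iff.mpr (neg_nonpos.mpr ?_)
    have := (Real.log_nonneg one_le_two).trans (h.log_two_le N)
    have := h.exponent_pos
    positivity
  have h3 : K * Real.exp (-(c * (N + 1) * Real.log (B N))) ≤ K :=
    mul_le_of_le_one_right (zero_le_one.trans h.one_le_const) h2
  have h4 := abs_sub_abs_le_abs_sub (A N / B N : ℝ) L
  rw [abs_sub_comm] at h4
  linarith

theorem liouville (h : IsFastApproximation L A B c K D) : Liouville L := by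
  intro n
  obtain ⟨N, hN⟩ := (h.eventually_abs_sub_lt n 0).exists
  refine ⟨A N, B N, by exact_mod_cast h.two_le_denom N, by simpa using h.ne N, ?_⟩
  rw [add_zero, Real.exp_neg, mul_comm, Real.exp_mul, h.exp_log_denom, Real.rpow_natCast] at hN
  simpa using hN

theorem transcendental_add (h : IsFastApproximation L A B c K D) {ξ : ℂ} (hξ : IsIntegral ℚ ξ) :
    Transcendental ℚ (ξ + L) := by
  intro halg
  have h1 : IsAlgebraic ℚ (algebraMap ℝ ℂ L) := by
    have := halg.sub hξ.isAlgebraic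
    rwa [add_sub_cancel_left] at this
  have h2 : IsAlgebraic ℤ (algebraMap ℝ ℂ L) := (IsFractionRing.isAlgebraic_iff ℤ ℚ ℂ).mpr h1
  exact h.liouville.transcendental ((isAlgebraic_algebraMap_iff (algebraMap ℝ ℂ).injective).mp h2)

theorem norm_add_sub_add (ξ : ℂ) (N : ℕ) :
    ‖ξ + L - (ξ + A N / B N)‖ = |L - A N / B N| := by
  rw [add_sub_add_left_eq_sub, ← Real.norm_eq_abs, ← Complex.norm_real]
  push_cast
  rfl

-- The translates are eventually good approximations. They converge to `ξ + L` without attaining it,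
-- which is impossible inside a finite, hence closed, set.
open Polynomial in
theorem infinite_goodApproximations (h : IsFastApproximation L A B c K D) {ξ : ℂ}
    (hξ : IsIntegral ℚ ξ) {w : ℝ} (hw : 0 < w) :
    (goodApproximations (ξ + L) (minpoly ℚ ξ).natDegree w).Infinite := by
  obtain ⟨C, hC1, hC⟩ := exists_isIntMinpoly_add_rat hξ (|L| + K)
  set m := (minpoly ℚ ξ).natDegree with hm
  have hC0 : 0 < C := one_pos.trans_le hC1
  have hmem : ∀ᶠ N in Filter.atTop, (ξ + A N / B N : ℂ) ∈ goodApproximations (ξ + L) m w := by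
    filter_upwards [h.eventually_abs_sub_lt (m * w) (Real.log C * w)] with N hN
    have hr : (ξ + A N / B N : ℂ) = ξ + ((A N / B N : ℚ) : ℂ) := by push_cast; rfl
    obtain ⟨P, hP, hPle⟩ := hC (A N) (B N) (h.denom_pos N) (h.abs_le N)
    refine ⟨?_, by rw [hr, natDegree_minpoly_add_rat], P, hP, ?_⟩
    · rw [hr]
      exact (hξ.add (isIntegral_algebraMap (R := ℚ) (x := (A N / B N : ℚ)))).isAlgebraic
    · rw [norm_add_sub_add]
      refine hN.trans_le ?_
      have hP1 := one_le_supNorm_of_ne_zero hP.1.ne_zero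
      have hB0 : (0 : ℝ) < B N := by exact_mod_cast h.denom_pos N
      calc _ = (C * (B N : ℝ) ^ m) ^ (-w) := by
            rw [Real.rpow_def_of_pos (by positivity), Real.log_mul hC0.ne' (by positivity),
              Real.log_pow]
            congr 1
            ring
        _ ≤ _ := Real.rpow_le_rpow_of_nonpos (by linarith) hPle (by linarith)
  intro hfin
  have hcl : IsClosed (goodApproximations (ξ + L) m w \ {(ξ + L : ℂ)}) :=
    (hfin.subset Set.sdiff_subset).isClosed
  have htend : Filter.Tendsto (fun N => (ξ + A N / B N : ℂ)) Filter.atTop (nhds (ξ + L)) := by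
    have := ((Complex.continuous_ofReal.tendsto L).comp h.tendsto).const_add ξ
    refine this.congr fun N => ?_
    simp
  refine (hcl.mem_of_tendsto htend ?_).2 rfl
  filter_upwards [hmem] with N hN
  refine ⟨hN, fun heq => h.ne N ?_⟩
  have h0 := norm_add_sub_add (L := L) (A := A) (B := B) ξ N
  rw [Set.mem_singleton_iff.mp heq, sub_self, norm_zero] at h0
  exact sub_eq_zero.mp (abs_eq_zero.mp h0.symm)

-- Each `η` of large height is tested against a translate chosen for it: the errors `|L - A_N /
-- B_N|` and `|γ - η|` each use at most half of the Liouville lower bound.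
open Polynomial in
theorem exists_not_infinite_goodApproximations (h : IsFastApproximation L A B c K D) {ξ : ℂ}
    (hξ : IsIntegral ℚ ξ) {k : ℕ} (hk : k < (minpoly ℚ ξ).natDegree) :
    ∃ w : ℝ, 0 < w ∧ ¬ (goodApproximations (ξ + L) k w).Infinite := by
  set γ : ℂ := ξ + L with hγ
  set R : ℝ := max (‖γ‖ + 1) (|L| + K) with hR
  obtain ⟨C, hC1, hC⟩ := exists_one_le_mul_norm_add_rat_sub hξ hk R
  set m := (minpoly ℚ ξ).natDegree with hm
  have hm1 : (1 : ℝ) ≤ m := by exact_mod_cast (Nat.zero_le k).trans_lt hk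
  obtain ⟨T₀, hT₀⟩ := exists_mem_interval_of_superlinear (ℓ := fun N => Real.log (B N))
    (t := m * k) (Real.log_pos one_lt_two) h.log_two_le h.growth_nonneg h.log_denom_succ_le
    h.exponent_pos
  set W : ℝ := 2 * D / c with hW
  have hc := h.exponent_pos
  have hD := h.growth_nonneg
  have hW0 : 0 ≤ W := by positivity
  have hK0 : 0 < K := one_pos.trans_le h.one_le_const
  have hC0 : 0 < C := one_pos.trans_le hC1
  have hlog2 : 0 < Real.log 2 := Real.log_pos one_lt_two
  have hlogK := Real.log_nonneg h.one_le_const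
  have hlogC := Real.log_nonneg hC1
  set κ : ℝ := Real.log C + Real.log K + Real.log 2 with hκ
  have hκ0 : 0 ≤ κ := by positivity
  -- With `ℓ ≤ W (m + 1) y`, the last two terms pay for `H ^ m` and `B ^ (mk)`; the leading `1`
  -- leaves `y > κ` for the constants.
  set w : ℝ := 1 + m + m * k * (W * (m + 1)) with hw
  have hw0 : 0 < w := by positivity
  refine ⟨w, hw0, fun hinf => ?_⟩
  obtain ⟨η, P, hP0, hPdeg, hPη, hPgt, hη⟩ :=
    exists_mem_goodApproximations_supNorm_gt hinf (Real.exp (max κ T₀))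
  have hH0 : 0 < P.supNorm := (Real.exp_pos _).trans hPgt
  set y : ℝ := Real.log P.supNorm with hy
  have hHy : Real.exp y = P.supNorm := Real.exp_log hH0
  have hmax : max κ T₀ < y := by rwa [hy, Real.lt_log_iff_exp_lt hH0]
  have hyκ : κ < y := (le_max_left _ _).trans_lt hmax
  have hyT : T₀ < y := (le_max_right _ _).trans_lt hmax
  have hy0 : 0 < y := hκ0.trans_lt hyκ
  have hmy : y ≤ m * y := le_mul_of_one_le_left hy0.le hm1
  -- The threshold `m y + κ` is exactly what makes the rational error times `C B ^ (mk) H ^ m` less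
  -- than `1 / 2`.
  obtain ⟨N, hTN, hℓN⟩ := hT₀ (m * y + κ) (by linarith)
  have hBexp := h.exp_log_denom N
  set ℓ : ℝ := Real.log (B N) with hℓ
  have hηexp : ‖γ - η‖ < Real.exp (-(w * y)) := by
    refine hη.trans_eq ?_
    rw [Real.rpow_def_of_pos hH0, ← hy]
    congr 1
    ring
  have hηR : ‖η‖ ≤ R := by
    have h1 : Real.exp (-(w * y)) ≤ 1 :=
      Real.exp_le_one_iff.mpr (neg_nonpos.mpr (by positivity))
    have h2 : ‖η‖ ≤ ‖γ‖ + ‖γ - η‖ := by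
      have := norm_sub_le γ (γ - η)
      rwa [sub_sub_cancel] at this
    exact (by linarith : ‖η‖ ≤ ‖γ‖ + 1).trans (le_max_left _ _)
  have key := hC P η hP0 hPdeg hPη hηR (A N) (B N) (h.denom_pos N)
    ((h.abs_le N).trans (le_max_right _ _))
  have hdist : ‖ξ + A N / B N - η‖ <
      Real.exp (Real.log K - c * (N + 1) * ℓ) + Real.exp (-(w * y)) := by
    have h1 : ‖ξ + A N / B N - η‖ ≤ ‖ξ + L - (ξ + A N / B N)‖ + ‖γ - η‖ := by
      have h2 : ξ + A N / B N - η = (γ - η) - (ξ + L - (ξ + A N / B N)) := by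
        rw [hγ]
        ring
      rw [h2]
      exact (norm_sub_le _ _).trans_eq (add_comm _ _)
    rw [norm_add_sub_add] at h1
    have h3 := h.abs_sub_le N
    rw [sub_eq_add_neg (Real.log K), Real.exp_add, Real.exp_log hK0]
    linarith
  have hfac : C * (B N : ℝ) ^ (m * k) * P.supNorm ^ m =
      Real.exp (Real.log C + m * k * ℓ + m * y) := by
    rw [Real.exp_add, Real.exp_add, Real.exp_log hC0, mul_comm _ ℓ, mul_comm _ y, Real.exp_mul,
      Real.exp_mul, hHy, hBexp]
    norm_cast
  rw [hfac] at key
  have hhalf : Real.exp (-Real.log 2) = 1 / 2 := by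
    rw [Real.exp_neg, Real.exp_log two_pos, one_div]
  have hlt : Real.exp (Real.log C + m * k * ℓ + m * y) *
      ‖ξ + A N / B N - η‖ < 1 / 2 + 1 / 2 := by
    refine (mul_lt_mul_of_pos_left hdist (Real.exp_pos _)).trans_le ?_
    rw [mul_add, ← Real.exp_add, ← Real.exp_add, ← hhalf]
    refine add_le_add (Real.exp_le_exp.mpr ?_) (Real.exp_le_exp.mpr ?_)
    · linarith
    · have h1 : m * y + κ ≤ (m + 1) * y := by linarith
      have h2 : ℓ ≤ W * ((m + 1) * y) := hℓN.trans (mul_le_mul_of_nonneg_left h1 hW0)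
      have h3 : (m * k : ℝ) * ℓ ≤ m * k * (W * ((m + 1) * y)) :=
        mul_le_mul_of_nonneg_left h2 (by positivity)
      have h4 : w * y = y + m * y + m * k * (W * ((m + 1) * y)) := by
        rw [hw]
        ring
      linarith
  linarith

theorem add_mem_UNumbers (h : IsFastApproximation L A B c K D) {ξ : ℂ} (hξ : IsIntegral ℚ ξ) :
    ξ + L ∈ UNumbers (minpoly ℚ ξ).natDegree := by
  refine ⟨h.transcendental_add hξ, ⟨minpoly.natDegree_pos hξ, fun w hw =>
    h.infinite_goodApproximations hξ hw⟩, fun k hk => ?_⟩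
  by_contra! hlt
  obtain ⟨w, hw, hfin⟩ := h.exists_not_infinite_goodApproximations hξ hlt
  exact hfin (hk.2 w hw)

end IsFastApproximation

/-! ### The tail of the Liouville series and the conclusion -/

/-- The exponents `(n + m)! / m` of `β ^ m` in the tail of the Liouville series at `β`. -/
def tailExponent (m n : ℕ) : ℕ := (n + m).factorial / m

theorem mul_tailExponent {m : ℕ} (hm : 0 < m) (n : ℕ) :
    m * tailExponent m n = (n + m).factorial :=
  Nat.mul_div_cancel' (Nat.dvd_factorial hm (Nat.le_add_left m n))

theorem tailExponent_succ {m : ℕ} (hm : 0 < m) (n : ℕ) :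
    tailExponent m (n + 1) = (n + m + 1) * tailExponent m n := by
  apply Nat.eq_of_mul_eq_mul_left hm
  rw [mul_tailExponent hm, mul_left_comm, mul_tailExponent hm, ← Nat.factorial_succ]
  congr 1
  omega

theorem tailExponent_pos {m : ℕ} (hm : 0 < m) (n : ℕ) : 0 < tailExponent m n :=
  Nat.pos_of_ne_zero fun h => (n + m).factorial_ne_zero <| by
    rw [← mul_tailExponent hm, h, mul_zero]

theorem tailExponent_strictMono {m : ℕ} (hm : 0 < m) : StrictMono (tailExponent m) :=
  strictMono_nat_of_lt_succ fun n => by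
    rw [tailExponent_succ hm]
    exact lt_mul_of_one_lt_left (tailExponent_pos hm n) (by omega)

theorem tailExponent_add_le {m : ℕ} (hm : 0 < m) (n j : ℕ) :
    j + tailExponent m n ≤ tailExponent m (j + n) := by
  induction j with
  | zero => simp
  | succ j ih =>
    have := tailExponent_strictMono hm (Nat.lt_succ_self (j + n))
    rw [Nat.succ_add j n]
    omega

theorem summable_pow_tailExponent {m : ℕ} (hm : 0 < m) {x : ℝ} (h0 : 0 ≤ x) (h1 : x < 1) :
    Summable fun n => x ^ tailExponent m n :=
  Summable.of_nonneg_of_le (fun _ => pow_nonneg h0 _)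
    (fun _ => pow_le_pow_of_le_one h0 h1.le ((tailExponent_strictMono hm).le_apply))
    (summable_geometric_of_lt_one h0 h1)

theorem liouvilleSeries_eq_sum_add {m : ℕ} (hm : 0 < m) {x : ℝ} (h0 : 0 < x) (h1 : x < 1)
    {β : ℂ} (hβ : β ^ m = x) :
    liouvilleSeries β = ∑ n ∈ Finset.range (m - 1), β ^ (n + 1).factorial +
      ((∑' n, x ^ tailExponent m n : ℝ) : ℂ) := by
  have hβ1 : ‖β‖ < 1 := by
    refine (pow_lt_one_iff_of_nonneg (norm_nonneg β) hm.ne').mp ?_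
    rw [← norm_pow, hβ, Complex.norm_real, Real.norm_of_nonneg h0.le]
    exact h1
  rw [liouvilleSeries, ← (hasSum_liouvilleSeries hβ1).summable.sum_add_tsum_nat_add (m - 1),
    Complex.ofReal_tsum]
  congr 2
  funext n
  have : n + (m - 1) + 1 = n + m := by omega
  rw [this, ← mul_tailExponent hm, pow_mul, hβ, Complex.ofReal_pow]

theorem Rat.two_le_den_of_pos_of_lt_one {a : ℚ} (h0 : 0 < a) (h1 : a < 1) : 2 ≤ a.den := by
  by_contra! hlt
  have hd : a.den = 1 := by have := a.den_pos; omega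
  have hn : (a.num : ℚ) = a := Rat.coe_int_num_of_den_eq_one hd
  rw [← hn] at h0 h1
  have h2 : 0 < a.num := by exact_mod_cast h0
  have h3 : a.num < 1 := by exact_mod_cast h1
  omega

/-- The numerator of `∑ n ≤ N, a ^ tailExponent m n` over the denominator
`a.den ^ tailExponent m N`. -/
def partialSumNum (m : ℕ) (a : ℚ) (N : ℕ) : ℤ :=
  ∑ n ∈ Finset.range (N + 1),
    a.num ^ tailExponent m n * (a.den : ℤ) ^ (tailExponent m N - tailExponent m n)

theorem partialSumNum_div {m : ℕ} (hm : 0 < m) (a : ℚ) (N : ℕ) :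
    ((partialSumNum m a N : ℝ) / ((a.den ^ tailExponent m N : ℕ) : ℝ)) =
      ∑ n ∈ Finset.range (N + 1), (a : ℝ) ^ tailExponent m n := by
  have hb0 : (a.den : ℝ) ≠ 0 := by exact_mod_cast a.den_pos.ne'
  rw [partialSumNum]
  push_cast
  rw [Finset.sum_div]
  refine Finset.sum_congr rfl fun n hn => ?_
  have hle : tailExponent m n ≤ tailExponent m N :=
    (tailExponent_strictMono hm).monotone (Nat.lt_succ_iff.mp (Finset.mem_range.mp hn))
  have ha : (a : ℝ) = a.num / a.den := by exact_mod_cast (Rat.num_div_den a).symm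
  rw [ha, div_pow, div_eq_div_iff (pow_ne_zero _ hb0) (pow_ne_zero _ hb0), mul_assoc, ← pow_add,
    Nat.sub_add_cancel hle]

/-- The exponents increase by at least one at each step, so a geometric series dominates the
remainder. -/
theorem tsum_pow_tailExponent_sub_sum {m : ℕ} (hm : 0 < m) {x : ℝ} (h0 : 0 < x) (h1 : x < 1)
    (N : ℕ) :
    0 < (∑' n, x ^ tailExponent m n) - ∑ n ∈ Finset.range (N + 1), x ^ tailExponent m n ∧
      (∑' n, x ^ tailExponent m n) - ∑ n ∈ Finset.range (N + 1), x ^ tailExponent m n ≤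
        1 / (1 - x) * x ^ tailExponent m (N + 1) := by
  have hsum := summable_pow_tailExponent hm h0.le h1
  have hsum' : Summable fun j => x ^ tailExponent m (j + (N + 1)) :=
    (summable_nat_add_iff (f := fun n => x ^ tailExponent m n) (N + 1)).mpr hsum
  rw [← hsum.sum_add_tsum_nat_add (N + 1), add_sub_cancel_left]
  refine ⟨hsum'.tsum_pos (fun j => pow_nonneg h0.le _) 0 (pow_pos h0 _), ?_⟩
  have hle : ∑' j, x ^ tailExponent m (j + (N + 1)) ≤
      ∑' j, x ^ tailExponent m (N + 1) * x ^ j := by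
    refine hsum'.tsum_le_tsum (fun j => ?_)
      ((summable_geometric_of_lt_one h0.le h1).mul_left _)
    rw [← pow_add, add_comm (tailExponent m (N + 1))]
    exact pow_le_pow_of_le_one h0.le h1.le (tailExponent_add_le hm _ _)
  refine hle.trans_eq ?_
  rw [tsum_mul_left, tsum_geometric_of_lt_one h0.le h1, mul_comm, one_div]

/-- The exponent constant `c` is defined by `a.den ^ (-c) = a`, which turns powers of `a` into
powers of the denominator; `D = m + 1` comes from `N + m + 1 ≤ (m + 1)(N + 1)`. -/
theorem isFastApproximation_tsum_pow {m : ℕ} (hm : 0 < m) {a : ℚ} (h0 : 0 < a) (h1 : a < 1) :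
    IsFastApproximation (∑' n, (a : ℝ) ^ tailExponent m n) (partialSumNum m a)
      (fun N => a.den ^ tailExponent m N) (-Real.log a / Real.log a.den) (1 / (1 - a))
      (m + 1) := by
  have hx0 : (0 : ℝ) < a := by exact_mod_cast h0
  have hx1 : (a : ℝ) < 1 := by exact_mod_cast h1
  have hden := Rat.two_le_den_of_pos_of_lt_one h0 h1
  have hlogb : 0 < Real.log a.den := Real.log_pos (by exact_mod_cast hden)
  have hloga : Real.log a < 0 := Real.log_neg hx0 hx1
  have htail := tsum_pow_tailExponent_sub_sum hm hx0 hx1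
  refine ⟨div_pos (neg_pos.mpr hloga) hlogb, ?_, by positivity, fun N => ?_, fun N => ?_,
    fun N => ?_, fun N => ?_⟩
  · rw [le_div_iff₀ (by linarith)]
    linarith
  · exact hden.trans (Nat.le_self_pow (tailExponent_pos hm N).ne' _)
  · rw [Nat.cast_pow, Nat.cast_pow, Real.log_pow, Real.log_pow, tailExponent_succ hm,
      Nat.cast_mul, mul_assoc]
    have h2 : ((N + m + 1 : ℕ) : ℝ) ≤ (m + 1) * (N + 1) := by
      have : (0 : ℝ) ≤ m * N := by positivity
      push_cast
      linarith
    exact mul_le_mul_of_nonneg_right h2 (by positivity)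
  · rw [partialSumNum_div hm]
    exact (sub_pos.mp (htail N).1).ne'
  · rw [partialSumNum_div hm, abs_of_pos (htail N).1]
    refine (htail N).2.trans (mul_le_mul_of_nonneg_left ?_ (one_div_nonneg.mpr (by linarith)))
    have hexp : -Real.log a / Real.log a.den * (N + 1) *
        Real.log ((a.den ^ tailExponent m N : ℕ) : ℝ) =
        -((((N + 1) * tailExponent m N : ℕ) : ℝ) * Real.log a) := by
      rw [Nat.cast_pow, Real.log_pow]
      push_cast
      field_simp
    rw [hexp, neg_neg, ← Real.log_pow, Real.exp_log (pow_pos hx0 _)]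
    refine pow_le_pow_of_le_one hx0.le hx1.le ?_
    rw [tailExponent_succ hm]
    exact Nat.mul_le_mul_right _ (by omega)

theorem liouvilleSeries_mem_UNumbers {m : ℕ} (hm : 0 < m) {a : ℚ} (h0 : 0 < a) (h1 : a < 1)
    (hroot : ∀ p : ℕ, p.Prime → p ∣ m → ¬ ∃ r : ℚ, r ^ p = a) {β : ℂ} (hβ : β ^ m = (a : ℂ)) :
    liouvilleSeries β ∈ UNumbers m := by
  have hint := (natDegree_minpoly_of_pow_eq hm h0 hroot hβ).1
  have hsum : IsIntegral ℚ (∑ n ∈ Finset.range (m - 1), β ^ (n + 1).factorial) :=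
    IsIntegral.sum _ fun n _ => hint.pow (n + 1).factorial
  have h := (isFastApproximation_tsum_pow hm h0 h1).add_mem_UNumbers hsum
  rw [natDegree_minpoly_sum_factorial hm h0 hroot hβ] at h
  rwa [liouvilleSeries_eq_sum_add hm (x := (a : ℝ)) (by exact_mod_cast h0) (by exact_mod_cast h1)
    (by simpa using hβ)]

/-- The 2-adic valuation of `1 / 2` is `-1`, not a multiple of `p`. -/
theorem Rat.pow_ne_one_half {p : ℕ} (hp : p.Prime) (r : ℚ) : r ^ p ≠ 1 / 2 := by
  intro h
  have : Fact (Nat.Prime 2) := ⟨Nat.prime_two⟩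
  have hr : r ≠ 0 := by
    rintro rfl
    rw [zero_pow hp.ne_zero] at h
    norm_num at h
  have hv := congrArg (padicValRat 2) h
  have h2 : padicValRat 2 (2 : ℚ) = 1 := by exact_mod_cast padicValRat.self one_lt_two
  rw [padicValRat.pow, one_div, padicValRat.inv, h2] at hv
  have hdvd : (p : ℤ) ∣ 1 := ⟨-padicValRat 2 r, by linarith⟩
  exact hp.one_lt.ne' (by exact_mod_cast Int.eq_one_of_dvd_one (by positivity) hdvd)

theorem mainTheorem5 (m : ℕ) (hm : 0 < m) :
    (∀ α : ℚ, 0 < α → α < 1 →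
      (∀ p : ℕ, p.Prime → p ∣ m → ¬ ∃ r : ℚ, r ^ p = α) →
      ∀ β : ℂ, β ^ m = (α : ℂ) → liouvilleSeries β ∈ UNumbers m) ∧
    liouvilleSeries (((2 : ℝ) ^ (-(1 / (m : ℝ))) : ℝ) : ℂ) ∈ UNumbers m := by
  refine ⟨fun α h0 h1 hroot β hβ => liouvilleSeries_mem_UNumbers hm h0 h1 hroot hβ,
    liouvilleSeries_mem_UNumbers hm (a := 1 / 2) (by norm_num) (by norm_num)
      (fun p hp _ ⟨r, hr⟩ => Rat.pow_ne_one_half hp r hr) ?_⟩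
  have hm' : (m : ℝ) ≠ 0 := by exact_mod_cast hm.ne'
  rw [← Complex.ofReal_pow, ← Real.rpow_mul_natCast two_pos.le, neg_mul, one_div_mul_cancel hm',
    Real.rpow_neg_one]
  norm_num
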